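/- Let $g, p \ge 0$ be integers, and let $F_{g,p}$ be the free group of rank $2g+p$ with basis $t_1,\dots,t_p,\,x_1,\dots,x_g,\,y_1,\dots,y_g$. Write $[u,v] = u^{-1}v^{-1}uv$, and let $$V_0 = t_p t_{p-1}\cdots t_1\,[x_1,y_1][x_2,y_2]\cdots[x_g,y_g] \in F_{g,p},$$ where empty products are $1$. Let $\phi$ be an endomorphism of $F_{g,p}$ such that $\phi$ is surjective or injective, $\phi(V_0) = V_0$, and there exists a permutation $\pi$ of $\{1,\dots,p\}$ such that, for each $j \in \{1,\dots,p\}$, $\phi(t_j)$ is conjugate in $F_{g,p}$ to $t_{\pi(j)}$. Then $\phi$ is an automorphism of $F_{g,p}$. -/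

import Mathlib

namespace ZieschangMcCool

/-- The free group `F_{g,p}` with distinguished basis
`t_1, …, t_p, x_1, …, x_g, y_1, …, y_g` (indexed from `0` here). -/
abbrev F (g p : ℕ) : Type := FreeGroup (Fin p ⊕ (Fin g ⊕ Fin g))

variable {g p : ℕ}

/-- The basis element `t_{j+1}`. -/
def t (j : Fin p) : F g p := FreeGroup.of (Sum.inl j)

/-- The basis element `x_{i+1}`. -/
def x (i : Fin g) : F g p := FreeGroup.of (Sum.inr (Sum.inl i))

/-- The basis element `y_{i+1}`. -/
def y (i : Fin g) : F g p := FreeGroup.of (Sum.inr (Sum.inr i))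

/-- The commutator with the convention `[u,v] = u⁻¹ v⁻¹ u v`. -/
def surfComm {G : Type*} [Group G] (u v : G) : G := u⁻¹ * v⁻¹ * u * v

/-- The element `t_p t_{p-1} ⋯ t_1 [x_1,y_1] [x_2,y_2] ⋯ [x_g,y_g]` of `F_{g,p}`. -/
def surfaceWord (g p : ℕ) : F g p :=
  ((List.ofFn fun j : Fin p => (t j : F g p)).reverse).prod *
    (List.ofFn fun i : Fin g => surfComm (x i : F g p) (y i)).prod

end ZieschangMcCool

/-! ### Integer cocycles on Schreier graphs -/

namespace ZieschangMcCool

/-! Let `F` act on the cosets of `H = φ(F)`, with base point `q = H`. A cocycle `d` on the Schreier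
graph restricts at `q` to a homomorphism `H → ℤ`. If `d` vanishes on all loops labelled `t j`, its
pullback by `φ` kills every `t j`, hence the surface word `V₀` (a product of `t`'s and commutators);
as `φ` fixes `V₀`, `d V₀ q = 0`. So the path `V₀` from `q` crosses each edge, `t`-loops aside, zero
times in total. Each `t j` occurs once in `V₀`, and each `x i`, `y i` once with either sign, which
forces every generator to fix `q`. Thus `H = F`, and the Hopf property supplies injectivity when it
is not assumed. -/

/-- A `ℤ`-valued crossed homomorphism on a group acting on `X`, with one component per point. -/
def IsCocycle {G X : Type*} [Group G] [MulAction G X] (d : G → X → ℤ) : Prop :=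
  ∀ u v q, d (u * v) q = d u (v • q) + d v q

namespace IsCocycle

variable {G X : Type*} [Group G] [MulAction G X] {d : G → X → ℤ}

theorem map_one (hd : IsCocycle d) (q : X) : d 1 q = 0 := by
  have h := hd 1 1 q
  simp only [one_smul, mul_one] at h
  omega

theorem map_inv (hd : IsCocycle d) (u : G) (q : X) : d u⁻¹ q = -d u (u⁻¹ • q) := by
  have h := hd u u⁻¹ q
  rw [mul_inv_cancel, hd.map_one] at h
  omega

/-- The contributions of the approach path `u⁻¹` and the return `u` cancel around a loop. -/
theorem map_conj_of_smul_eq (hd : IsCocycle d) {u v : G} {q : X}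
    (h : v • u⁻¹ • q = u⁻¹ • q) : d (u * v * u⁻¹) q = d v (u⁻¹ • q) := by
  rw [hd, hd, h, hd.map_inv]
  omega

theorem map_surfComm (hd : IsCocycle d) (u v : G) (q : X) :
    d (surfComm u v) q =
      d v q + d u (v • q) - d v (v⁻¹ • u • v • q) - d u (u⁻¹ • v⁻¹ • u • v • q) := by
  simp only [surfComm, hd _ _ _, hd.map_inv]
  omega

theorem map_list_prod_eq_zero (hd : IsCocycle d) {l : List G} (h : ∀ u ∈ l, ∀ q, d u q = 0)
    (q : X) : d l.prod q = 0 := by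
  induction l with
  | nil => exact hd.map_one q
  | cons u l ih =>
    rw [List.prod_cons, hd, h u (by simp), ih fun v hv => h v (by simp [hv]), add_zero]

/-- The homomorphism obtained by evaluating a cocycle at a point fixed by the image of `f`. -/
def evalHom (hd : IsCocycle d) {K : Type*} [Group K] (f : K →* G) (q : X)
    (hq : ∀ k, f k • q = q) : K →* Multiplicative ℤ where
  toFun k := Multiplicative.ofAdd (d (f k) q)
  map_one' := by rw [_root_.map_one, hd.map_one]; rfl
  map_mul' u v := by rw [map_mul, hd, hq, ofAdd_add]

end IsCocycle

/-- Weights on the Schreier edges of an action of a free group extend to a cocycle. -/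
theorem exists_isCocycle {α X : Type*} [MulAction (FreeGroup α) X] (c : α → X → ℤ) :
    ∃ d : FreeGroup α → X → ℤ, IsCocycle d ∧ ∀ a q, d (FreeGroup.of a) q = c a q := by
  -- Skew product action: the `ℤ`-coordinate accumulates the weights, and its displacement is the
  -- cocycle.
  let Φ : FreeGroup α →* Equiv.Perm (X × ℤ) := FreeGroup.lift fun a =>
    Equiv.prodShear (MulAction.toPerm (FreeGroup.of a)) fun q => Equiv.addRight (c a q)
  have hof : ∀ a q n, Φ (FreeGroup.of a) (q, n) = (FreeGroup.of a • q, n + c a q) := by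
    intro a q n
    simp [Φ]
  have key : ∀ w : FreeGroup α, ∀ q n, Φ w (q, n) = (w • q, n + (Φ w (q, 0)).2) := by
    intro w
    induction w using FreeGroup.induction_on with
    | C1 => simp
    | of a => intro q n; simp [hof]
    | inv_of a _ =>
      have hinv : ∀ q n, Φ (FreeGroup.of a)⁻¹ (q, n) =
          ((FreeGroup.of a)⁻¹ • q, n - c a ((FreeGroup.of a)⁻¹ • q)) := by
        intro q n
        rw [map_inv, Equiv.Perm.inv_eq_iff_eq, hof]
        simp
      intro q n
      rw [hinv, hinv]
      simp [sub_eq_add_neg]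
    | mul u v hu hv =>
      intro q n
      rw [map_mul, Equiv.Perm.mul_apply, Equiv.Perm.mul_apply, hv q n, hu, hv q 0, hu _ (0 + _)]
      simp [mul_smul, add_assoc]
  refine ⟨fun w q => (Φ w (q, 0)).2, fun u v q => ?_, fun a q => by simp [hof]⟩
  simp only [map_mul, Equiv.Perm.mul_apply]
  rw [key v q 0, key u]
  simp [add_comm]

/-- `d` counts the signed traversals of the Schreier edge labelled `b` that starts at `r`. -/
structure IsEdgeCocycle {α X : Type*} [MulAction (FreeGroup α) X] (b : α) (r : X)
    (d : FreeGroup α → X → ℤ) : Prop where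
  isCocycle : IsCocycle d
  map_self : d (FreeGroup.of b) r = 1
  map_of_ne : ∀ q, q ≠ r → d (FreeGroup.of b) q = 0
  map_of : ∀ a, a ≠ b → ∀ q, d (FreeGroup.of a) q = 0

theorem exists_isEdgeCocycle {α X : Type*} [MulAction (FreeGroup α) X] (b : α) (r : X) :
    ∃ d : FreeGroup α → X → ℤ, IsEdgeCocycle b r d := by
  classical
  obtain ⟨d, hd, h⟩ :=
    exists_isCocycle (X := X) fun (a : α) q => if a = b ∧ q = r then (1 : ℤ) else 0
  exact ⟨d, hd, by simp [h], fun q hq => by simp [h, hq], fun a ha q => by simp [h, ha]⟩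

theorem map_surfaceWord_eq_one {A : Type*} [CommGroup A] {g p : ℕ} (f : F g p →* A)
    (hf : ∀ j, f (t j) = 1) : f (surfaceWord g p) = 1 := by
  rw [surfaceWord, map_mul, map_list_prod, map_list_prod, List.prod_eq_one, List.prod_eq_one,
    one_mul]
  · simp only [List.map_ofFn, List.mem_ofFn, Function.comp_apply, forall_exists_index,
      forall_apply_eq_imp_iff]
    intro i
    simp only [surfComm, map_mul, map_inv]
    rw [mul_comm (f (x i))⁻¹, inv_mul_cancel_right, inv_mul_cancel]
  · simp only [List.map_reverse, List.map_ofFn, List.mem_reverse, List.mem_ofFn,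
      Function.comp_apply, forall_exists_index, forall_apply_eq_imp_iff]
    exact hf

/-! ### Reading the surface word along the Schreier graph -/

section Reading

variable {g p : ℕ} {X : Type*} [MulAction (F g p) X]

theorem IsCocycle.map_surfComm_eq_zero {d : F g p → X → ℤ} (hd : IsCocycle d) {i : Fin g}
    (hx : ∀ q, d (x i) q = 0) (hy : ∀ q, d (y i) q = 0) (q : X) :
    d (surfComm (x i) (y i)) q = 0 := by
  simp [hd.map_surfComm, hx, hy]

/-- If the commutator loop at `q` traverses every edge zero times in total, then
`x i` and `y i` fix `q`. -/
theorem smul_eq_of_surfComm {q : X} (i : Fin g)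
    (hx : ∀ r, ∀ d : F g p → X → ℤ, IsEdgeCocycle (Sum.inr (Sum.inl i)) r d →
      d (surfComm (x i) (y i)) q = 0)
    (hy : ∀ r, ∀ d : F g p → X → ℤ, IsEdgeCocycle (Sum.inr (Sum.inr i)) r d →
      d (surfComm (x i) (y i)) q = 0) :
    (x i : F g p) • q = q ∧ (y i : F g p) • q = q := by
  -- Words are read from the right. The forward `y i`-edge starts at `q`, and the edge crossed
  -- backwards must be the same one.
  have h1 : (y i : F g p)⁻¹ • (x i : F g p) • (y i : F g p) • q = q := by
    obtain ⟨d, hd⟩ := exists_isEdgeCocycle (α := Fin p ⊕ (Fin g ⊕ Fin g)) (Sum.inr (Sum.inr i)) q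
    have h := hy q d hd
    by_contra hne
    have e1 : d (y i) q = 1 := hd.map_self
    have e2 : ∀ r, d (x i) r = 0 := hd.map_of _ (by simp)
    have e3 : d (y i) _ = 0 := hd.map_of_ne _ hne
    rw [hd.isCocycle.map_surfComm, e1, e2, e2, e3] at h
    omega
  have h2 : (x i : F g p)⁻¹ • q = (y i : F g p) • q := by
    obtain ⟨d, hd⟩ := exists_isEdgeCocycle (α := Fin p ⊕ (Fin g ⊕ Fin g)) (Sum.inr (Sum.inl i)) ((y i : F g p) • q)
    have h := hx _ d hd
    by_contra hne
    have e1 : d (x i) ((y i : F g p) • q) = 1 := hd.map_self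
    have e2 : ∀ r, d (y i) r = 0 := hd.map_of _ (by simp)
    have e3 : d (x i) _ = 0 := hd.map_of_ne _ hne
    rw [hd.isCocycle.map_surfComm, e1, e2, e2, h1, e3] at h
    omega
  have h3 : (y i : F g p) • q = q := by
    rw [inv_smul_eq_iff] at h1 h2
    rw [← h1, ← h2]
  refine ⟨?_, h3⟩
  rw [h3, inv_smul_eq_iff] at h2
  exact h2.symm

theorem smul_list_prod_eq {G Y : Type*} [Group G] [MulAction G Y] {l : List G} {q : Y}
    (h : ∀ u ∈ l, u • q = q) : l.prod • q = q := by
  induction l with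
  | nil => simp
  | cons u l ih =>
    rw [List.prod_cons, mul_smul, ih fun v hv => h v (by simp [hv]), h u (by simp)]

theorem surfComm_smul_eq {G Y : Type*} [Group G] [MulAction G Y] {u v : G} {q : Y}
    (hu : u • q = q) (hv : v • q = q) : surfComm u v • q = q := by
  simp only [surfComm, mul_smul, hu, hv, inv_smul_eq_iff]

theorem smul_eq_of_surfComm_list {q : X} (l : List (Fin g)) (hl : l.Nodup)
    (h : ∀ b r, ∀ d : F g p → X → ℤ, IsEdgeCocycle (Sum.inr b) r d →
      d (l.map fun i => surfComm (x i) (y i)).prod q = 0) :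
    ∀ i ∈ l, (x i : F g p) • q = q ∧ (y i : F g p) • q = q := by
  -- Testing only letters indexed by `l` lets the hypothesis pass to the tail, where the head
  -- contributes zero.
  suffices H : ∀ l : List (Fin g), l.Nodup →
      (∀ b r, ∀ d : F g p → X → ℤ, IsEdgeCocycle (Sum.inr b) r d → Sum.elim id id b ∈ l →
        d (l.map fun i => surfComm (x i) (y i)).prod q = 0) →
      ∀ i ∈ l, (x i : F g p) • q = q ∧ (y i : F g p) • q = q from
    H l hl fun b r d hd _ => h b r d hd
  intro l hl h
  induction l with
  | nil => simp
  | cons i l ih =>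
    obtain ⟨hi, hl⟩ := List.nodup_cons.mp hl
    have hzero : ∀ b r, ∀ d : F g p → X → ℤ, IsEdgeCocycle (Sum.inr b) r d →
        ∀ k, k ≠ Sum.elim id id b → ∀ q, d (surfComm (x k) (y k)) q = 0 := by
      intro b r d hd k hk
      refine hd.isCocycle.map_surfComm_eq_zero (hd.map_of _ ?_) (hd.map_of _ ?_) <;>
      · rintro ⟨⟩
        exact hk rfl
    have hfix := ih hl fun b r d hd hb => by
      have h := h b r d hd (List.mem_cons_of_mem _ hb)
      rwa [List.map_cons, List.prod_cons, hd.isCocycle, hzero b r d hd i, zero_add] at h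
      rintro rfl
      exact hi hb
    have hprod : (l.map fun i => surfComm (x i) (y i) : List (F g p)).prod • q = q := by
      refine smul_list_prod_eq fun u hu => ?_
      obtain ⟨k, hk, rfl⟩ := List.mem_map.mp hu
      exact surfComm_smul_eq (hfix k hk).1 (hfix k hk).2
    have hhead : ∀ b r, ∀ d : F g p → X → ℤ, IsEdgeCocycle (Sum.inr b) r d →
        Sum.elim id id b = i → d (surfComm (x i) (y i)) q = 0 := by
      intro b r d hd hb
      have h := h b r d hd (by simp [hb])
      rw [List.map_cons, List.prod_cons, hd.isCocycle, hprod,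
        hd.isCocycle.map_list_prod_eq_zero, add_zero] at h
      · exact h
      · intro u hu
        obtain ⟨k, hk, rfl⟩ := List.mem_map.mp hu
        refine hzero b r d hd k ?_
        rintro rfl
        exact hi (hb ▸ hk)
    intro k hk
    rcases List.mem_cons.mp hk with rfl | hk
    · exact smul_eq_of_surfComm k (fun r d hd => hhead _ r d hd rfl)
        fun r d hd => hhead _ r d hd rfl
    · exact hfix k hk

/-- Each letter occurs once, so a non-loop edge on the path would be counted exactly once. -/
theorem smul_eq_of_t_list {q : X} (l : List (Fin p)) (hl : l.Nodup)
    (h : ∀ j r, (t j : F g p) • r ≠ r → ∀ d : F g p → X → ℤ, IsEdgeCocycle (Sum.inl j) r d →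
      d (l.map t).prod q = 0) :
    ∀ j ∈ l, (t j : F g p) • q = q := by
  suffices H : ∀ l : List (Fin p), l.Nodup →
      (∀ j ∈ l, ∀ r, (t j : F g p) • r ≠ r → ∀ d : F g p → X → ℤ,
        IsEdgeCocycle (Sum.inl j) r d → d (l.map t).prod q = 0) →
      ∀ j ∈ l, (t j : F g p) • q = q from H l hl fun j _ => h j
  intro l hl h
  induction l with
  | nil => simp
  | cons i l ih =>
    obtain ⟨hi, hl⟩ := List.nodup_cons.mp hl
    have hzero : ∀ j r, ∀ d : F g p → X → ℤ, IsEdgeCocycle (Sum.inl j) r d →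
        ∀ k, k ≠ j → ∀ q, d (t k) q = 0 :=
      fun j r d hd k hk => hd.map_of _ fun e => hk (Sum.inl_injective e)
    have hfix := ih hl fun j hj r hr d hd => by
      have h := h j (List.mem_cons_of_mem _ hj) r hr d hd
      rwa [List.map_cons, List.prod_cons, hd.isCocycle, hzero j r d hd i, zero_add] at h
      rintro rfl
      exact hi hj
    have hprod : (l.map t : List (F g p)).prod • q = q := by
      refine smul_list_prod_eq fun u hu => ?_
      obtain ⟨k, hk, rfl⟩ := List.mem_map.mp hu
      exact hfix k hk
    intro k hk
    rcases List.mem_cons.mp hk with rfl | hk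
    · by_contra hne
      obtain ⟨d, hd⟩ := exists_isEdgeCocycle (α := Fin p ⊕ (Fin g ⊕ Fin g)) (Sum.inl k) q
      have h := h k (by simp) q hne d hd
      have e : d (t k) q = 1 := hd.map_self
      rw [List.map_cons, List.prod_cons, hd.isCocycle, hprod,
        hd.isCocycle.map_list_prod_eq_zero, e] at h
      · omega
      · intro u hu
        obtain ⟨m, hm, rfl⟩ := List.mem_map.mp hu
        refine hzero k q d hd m ?_
        rintro rfl
        exact hi hm
    · exact hfix k hk

/-- If no cocycle vanishing on the loops labelled `t j` detects the surface word at `q`, then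
`q` is a global fixed point. -/
theorem smul_eq_of_surfaceWord {q : X}
    (h : ∀ d : F g p → X → ℤ, IsCocycle d →
      (∀ j r, (t j : F g p) • r = r → d (t j) r = 0) → d (surfaceWord g p) q = 0)
    (w : F g p) : w • q = q := by
  have hword : surfaceWord g p = ((List.finRange p).reverse.map t).prod *
      ((List.finRange g).map fun i => surfComm (x i) (y i)).prod := by
    rw [surfaceWord, List.ofFn_eq_map, List.ofFn_eq_map, List.map_reverse]
  rw [hword] at h
  have hxy := smul_eq_of_surfComm_list (p := p) (q := q) (List.finRange g)
    (List.nodup_finRange g) fun b r d hd => by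
      have ht : ∀ j r, d (t j) r = 0 := fun j => hd.map_of _ (by simp)
      have h := h d hd.isCocycle fun j r _ => ht j r
      rwa [hd.isCocycle, hd.isCocycle.map_list_prod_eq_zero, zero_add] at h
      intro u hu
      obtain ⟨k, -, rfl⟩ := List.mem_map.mp hu
      exact ht k
  have hC : ((List.finRange g).map fun i => surfComm (x i) (y i) : List (F g p)).prod • q = q := by
    refine smul_list_prod_eq fun u hu => ?_
    obtain ⟨k, hk, rfl⟩ := List.mem_map.mp hu
    exact surfComm_smul_eq (hxy k hk).1 (hxy k hk).2
  have ht := smul_eq_of_t_list (g := g) (q := q) (List.finRange p).reverse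
    (List.nodup_reverse.mpr (List.nodup_finRange p)) fun j r hr d hd => by
      have h := h d hd.isCocycle fun k s hs => by
        by_cases hk : k = j
        · subst hk
          exact hd.map_of_ne s fun e => hr (e ▸ hs)
        · exact hd.map_of _ (fun e => hk (Sum.inl_injective e)) s
      rwa [hd.isCocycle, hC, hd.isCocycle.map_list_prod_eq_zero
        (l := (List.finRange g).map fun i => surfComm (x i) (y i)), add_zero] at h
      intro u hu
      obtain ⟨k, -, rfl⟩ := List.mem_map.mp hu
      exact hd.isCocycle.map_surfComm_eq_zero (hd.map_of _ (by simp)) (hd.map_of _ (by simp))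
  have hof : ∀ a, (FreeGroup.of a : F g p) • q = q := by
    rintro (j | i | i)
    · exact ht j (by simp)
    · exact (hxy i (by simp)).1
    · exact (hxy i (by simp)).2
  induction w using FreeGroup.induction_on with
  | C1 => exact one_smul _ q
  | of a => exact hof a
  | inv_of a _ => rw [inv_smul_eq_iff, hof]
  | mul u v hu hv => rw [mul_smul, hv, hu]

end Reading

/-! ### Surjectivity -/

theorem surjective_of_map_surfaceWord {g p : ℕ} (φ : F g p →* F g p)
    (hfix : φ (surfaceWord g p) = surfaceWord g p)
    (hconj : ∀ j, ∃ k, IsConj (φ (t j)) (t k)) : Function.Surjective φ := by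
  have hstab : ∀ w, φ w • ((1 : F g p) : F g p ⧸ φ.range) = ((1 : F g p) : F g p ⧸ φ.range) := by
    intro w
    rw [MulAction.Quotient.smul_coe, QuotientGroup.eq]
    simp
  intro w
  have hw := smul_eq_of_surfaceWord (q := ((1 : F g p) : F g p ⧸ φ.range)) (fun d hd ht => by
    have h := map_surfaceWord_eq_one (hd.evalHom φ _ hstab) fun j => by
      obtain ⟨k, hk⟩ := hconj j
      obtain ⟨c, hc⟩ := isConj_iff.mp hk.symm
      have hs := hstab (t j)
      -- Since `φ (t j) = c * t k * c⁻¹` fixes the base coset, `t k` labels a loop at its translate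
      -- by `c⁻¹`.
      rw [← hc, mul_smul, mul_smul, ← eq_inv_smul_iff] at hs
      change Multiplicative.ofAdd (d (φ (t j)) _) = 1
      rw [← hc, hd.map_conj_of_smul_eq hs, ht k _ hs]
      rfl
    rw [← hfix]
    exact h) w
  rw [MulAction.Quotient.smul_coe, QuotientGroup.eq] at hw
  simpa using hw

-- Residual finiteness and the Hopf property

universe u in
/-- Free groups are residually finite: some finite permutation representation detects `w`. -/
theorem exists_finite_perm_apply_ne_one {α : Type u} {w : FreeGroup α} (hw : w ≠ 1) :
    ∃ (A : Type u) (_ : Finite A) (f : FreeGroup α →* Equiv.Perm A), f w ≠ 1 := by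
  classical
  -- The suffixes of `w` are the vertices of the path from `1` to `w`. Left multiplication by a
  -- generator is a partial injection of this finite set, so it extends to a permutation.
  let S : Finset (FreeGroup α) := (w.toWord.tails.map FreeGroup.mk).toFinset
  have hS : ∀ L, L <:+ w.toWord → FreeGroup.mk L ∈ S := fun L hL => by
    simp only [S, List.mem_toFinset, List.mem_map, List.mem_tails]
    exact ⟨L, hL, rfl⟩
  let e (a : α) : {q : S // FreeGroup.of a * q.1 ∈ S} ≃ {q : S // (FreeGroup.of a)⁻¹ * q.1 ∈ S} :=
    { toFun := fun q => ⟨⟨_, q.2⟩, by simp⟩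
      invFun := fun q => ⟨⟨_, q.2⟩, by simp⟩
      left_inv := fun q => by simp
      right_inv := fun q => by simp }
  let σ (a : α) : Equiv.Perm S := (e a).extendSubtype
  have hσ : ∀ a (q : S) (h : FreeGroup.of a * q.1 ∈ S), σ a q = ⟨_, h⟩ := fun a q h =>
    (e a).extendSubtype_apply_of_mem q h
  have key : ∀ L, ∀ hL : L <:+ w.toWord,
      FreeGroup.lift σ (FreeGroup.mk L) ⟨1, hS [] List.nil_suffix⟩ = ⟨FreeGroup.mk L, hS L hL⟩ := by
    intro L
    induction L with
    | nil => intro _; rfl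
    | cons s L ih =>
      intro hL
      have hL' : L <:+ w.toWord := (List.suffix_cons s L).trans hL
      obtain ⟨a, b⟩ := s
      have hcons : FreeGroup.mk ((a, b) :: L) = FreeGroup.mk [(a, b)] * FreeGroup.mk L := by
        rw [FreeGroup.mul_mk, List.singleton_append]
      have hmem := hS _ hL
      simp only [hcons] at hmem ⊢
      rw [map_mul, Equiv.Perm.mul_apply, ih hL']
      cases b with
      | true =>
        simp only [show FreeGroup.mk [(a, true)] = FreeGroup.of a from rfl] at hmem ⊢
        rw [FreeGroup.lift_apply_of, hσ a _ hmem]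
      | false =>
        simp only [show FreeGroup.mk [(a, false)] = (FreeGroup.of a)⁻¹ from rfl] at hmem ⊢
        rw [map_inv, FreeGroup.lift_apply_of, Equiv.Perm.inv_eq_iff_eq, hσ a]
        · simp
        · simpa using hS L hL'
  refine ⟨S, inferInstance, FreeGroup.lift σ, fun h => hw ?_⟩
  have h1 := congrArg Subtype.val (key w.toWord List.suffix_rfl)
  simp only [FreeGroup.mk_toWord, h, Equiv.Perm.one_apply] at h1
  exact h1.symm

/-- Free groups of finite rank are Hopfian. -/
theorem injective_of_surjective {α : Type*} [Finite α] {φ : FreeGroup α →* FreeGroup α}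
    (hφ : Function.Surjective φ) : Function.Injective φ := by
  rw [injective_iff_map_eq_one]
  intro w hw
  by_contra hne
  obtain ⟨A, _, f, hf⟩ := exists_finite_perm_apply_ne_one hne
  -- Precomposition with `φ` is an injective self-map of a finite set, so `f` factors through `φ`
  -- and kills `w`.
  have : Finite (FreeGroup α →* Equiv.Perm A) := Finite.of_equiv _ FreeGroup.lift
  have hinj : Function.Injective fun f : FreeGroup α →* Equiv.Perm A => f.comp φ :=
    fun _ _ h => (MonoidHom.cancel_right hφ).mp h
  obtain ⟨f', rfl⟩ := Finite.surjective_of_injective hinj f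
  exact hf (by simp [hw])

end ZieschangMcCool

theorem mainTheorem4 (g p : ℕ) (φ : ZieschangMcCool.F g p →* ZieschangMcCool.F g p)
    (hφ : Function.Surjective φ ∨ Function.Injective φ)
    (hfix : φ (ZieschangMcCool.surfaceWord g p) = ZieschangMcCool.surfaceWord g p)
    (hconj : ∃ π : Equiv.Perm (Fin p), ∀ j : Fin p,
      IsConj (φ (ZieschangMcCool.t j)) (ZieschangMcCool.t (π j))) :
    ∃ ψ : MulAut (ZieschangMcCool.F g p), ∀ w : ZieschangMcCool.F g p, ψ w = φ w := by
  obtain ⟨π, hπ⟩ := hconj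
  have hsurj := ZieschangMcCool.surjective_of_map_surfaceWord φ hfix fun j => ⟨π j, hπ j⟩
  have hinj : Function.Injective φ :=
    hφ.elim (fun h => ZieschangMcCool.injective_of_surjective h) id
  exact ⟨MulEquiv.ofBijective φ ⟨hinj, hsurj⟩, fun _ => rfl⟩
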